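/- For an entire function $f$ let $M(r)=\max_{|z|=r}|f(z)|$, and let the order of $f$ be $\limsup_{r\to\infty}\frac{\log\log M(r)}{\log r}$. A transcendental entire function $f$ is called *2-log-regular* if for every $\varepsilon\in(0,1)$ there exist $R>0$ and $k>1$ such that $\mu_{2,\varepsilon}(\exp(r^k))\ge \exp(M(r)^k)$ for all $r\ge R$, where $\mu_{2,\varepsilon}$ is defined (for large $r$) by $\log\log\mu_{2,\varepsilon}(r)=\varepsilon\log\log M(r)$. It is called *strongly log-regular* if for every $\varepsilon\in(0,1)$ there exist $R>0$ and $k>1$ such that $\log M(r^k)\ge (k\log M(r))^{1/\varepsilon}$ for all $r>R$. Let $(t_n)_{n\ge 0}$ be any sequence of positive real numbers with $t_0>1$ and $t_n\le t_{n+1}^{3/4}$ for all $n\ge 0$. Let $\mu(t)=\exp(t^{1/2})$ and let $\phi$ be the function which on each interval $[t_{n+1}^{3/4},t_{n+1}]$, $n\ge 0$, is the linear function agreeing with $\mu$ at both end points, and which equals $\mu$ elsewhere on $(0,\infty)$. Then there exists a transcendental entire function $f$ of order zero (in particular, of finite order) such that $\log M(e^t)\sim\phi(t)$ as $t\to\infty$,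 and $f$ is 2-log-regular but not strongly log-regular. -/

import Mathlib

open Filter Asymptotics

noncomputable section

namespace LogReg

/-- A transcendental entire function: entire and not a polynomial. -/
def IsTranscendentalEntire (f : ℂ → ℂ) : Prop :=
  Differentiable ℂ f ∧ ¬ ∃ p : Polynomial ℂ, ∀ z, f z = p.eval z

/-- The maximum modulus `M(r) = max_{|z| = r} |f z|`. -/
def maxModulus (f : ℂ → ℂ) (r : ℝ) : ℝ :=
  sSup ((fun z => ‖f z‖) '' Metric.sphere (0 : ℂ) r)

/-- The order `limsup_{r → ∞} log log M(r) / log r`, as an extended real number. -/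
def order (f : ℂ → ℂ) : EReal :=
  limsup (fun r : ℝ =>
    ((Real.log (Real.log (maxModulus f r)) / Real.log r : ℝ) : EReal)) atTop

/-- The function `μ_{m,ε}` with `log^m μ_{m,ε}(r) = ε log^m M(r)`, where `log^m` is the `m`-fold
iterate; it is meaningful for all large `r`. -/
def mu (f : ℂ → ℂ) (m : ℕ) (ε r : ℝ) : ℝ :=
  Real.exp^[m] (ε * Real.log^[m] (maxModulus f r))

/-- The inequality of `m`-log-regularity (for `m ≥ 1`). -/
def IsMLogRegular (m : ℕ) (f : ℂ → ℂ) : Prop :=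
  ∀ ε : ℝ, 0 < ε → ε < 1 → ∃ R : ℝ, 0 < R ∧ ∃ k : ℝ, 1 < k ∧ ∀ r : ℝ, R ≤ r →
    Real.exp^[m - 1] (maxModulus f r ^ k) ≤ mu f m ε (Real.exp^[m - 1] (r ^ k))

/-- The inequality of strong log-regularity. -/
def IsStronglyLogRegular (f : ℂ → ℂ) : Prop :=
  ∀ ε : ℝ, 0 < ε → ε < 1 → ∃ R : ℝ, 0 < R ∧ ∃ k : ℝ, 1 < k ∧ ∀ r : ℝ, R < r →
    (k * Real.log (maxModulus f r)) ^ (1 / ε) ≤ Real.log (maxModulus f (r ^ k))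

/-- The function `t ↦ exp (t^{1/2})`. -/
def expSqrt (t : ℝ) : ℝ := Real.exp (t ^ (1 / 2 : ℝ))

/-- The linear function that agrees with `expSqrt` at `a` and at `b` (for `a ≠ b`). -/
def chord (a b t : ℝ) : ℝ :=
  expSqrt a + (expSqrt b - expSqrt a) / (b - a) * (t - a)

open Classical in
/-- The function which on each interval `[s_{n+1}^{3/4}, s_{n+1}]` is linear and agrees with
`expSqrt` at both end points, and which equals `expSqrt` elsewhere. (When two of the intervals share
an end point, both linear pieces take the value of `expSqrt` there, so the choice of `n` does not
matter.) -/
def piecewisePhi (s : ℕ → ℝ) (t : ℝ) : ℝ :=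
  if h : ∃ n : ℕ, t ∈ Set.Icc (s (n + 1) ^ (3 / 4 : ℝ)) (s (n + 1)) then
    chord (s (h.choose + 1) ^ (3 / 4 : ℝ)) (s (h.choose + 1)) t
  else expSqrt t

end LogReg

end

namespace LogReg

/-! ### The function `expSqrt` and its chords -/

/-! Write φ for `piecewisePhi s`. Chords of the convex function e^√t lie above it between their end
points and below it outside, so φ has a supporting line at every t ≥ 1
(`exists_subgradient_piecewisePhi`). By Legendre duality, the power series with coefficients
e^{-φ*(n)} then satisfies log M(e^t) = φ(t) + O(t), which is equivalent to φ(t) because φ(t) ≥ e^√t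
(`abs_log_maxModulus_conjSeries_sub_le`). The bounds e^√t ≤ φ(t) ≤ exp(t^{2/3}) alone give
transcendence, order zero and 2-log-regularity. Strong log-regularity fails at the nodes: near x = s
(n + 1) the function φ is linear over a long stretch, so φ(x) ≤ 2k φ(x/k) for large x, whereas
regularity would require a power growth. -/

lemma hasDerivAt_expSqrt {t : ℝ} (ht : 0 < t) :
    HasDerivAt expSqrt (Real.exp (√t) * (1 / (2 * √t))) t := by
  have h : expSqrt = fun t => Real.exp (√t) := by
    ext t
    rw [expSqrt, ← Real.sqrt_eq_rpow]
  rw [h]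
  exact (Real.hasDerivAt_sqrt ht.ne').exp

lemma expSqrt_pos (t : ℝ) : 0 < expSqrt t := Real.exp_pos _

lemma expSqrt_mono {a b : ℝ} (ha : 0 ≤ a) (h : a ≤ b) : expSqrt a ≤ expSqrt b :=
  Real.exp_le_exp.2 (Real.rpow_le_rpow ha h (by norm_num))

/-- With x = √t this is the derivative of `expSqrt`; it increases only from t = 1 on, hence the
half-line [1, ∞) throughout. -/
lemma exp_div_le_exp_div {x y : ℝ} (hx : 1 ≤ x) (hxy : x ≤ y) :
    Real.exp x * (1 / (2 * x)) ≤ Real.exp y * (1 / (2 * y)) := by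
  have hy : 0 < y := by linarith
  have hx' : 0 < x := by linarith
  have h : y ≤ x * Real.exp (y - x) := by
    nlinarith [Real.add_one_le_exp (y - x), mul_nonneg (sub_nonneg.2 hx) (sub_nonneg.2 hxy)]
  rw [mul_one_div, mul_one_div, div_le_div_iff₀ (by positivity) (by positivity)]
  have h2 : Real.exp y = Real.exp x * Real.exp (y - x) := by
    rw [← Real.exp_add]
    congr 1
    ring
  rw [h2]
  nlinarith [mul_le_mul_of_nonneg_left h (Real.exp_pos x).le]

lemma convexOn_expSqrt : ConvexOn ℝ (Set.Ici 1) expSqrt := by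
  have hd : ∀ t ∈ Set.Ici (1 : ℝ), HasDerivAt expSqrt _ t := fun t ht =>
    hasDerivAt_expSqrt (lt_of_lt_of_le one_pos ht)
  refine MonotoneOn.convexOn_of_deriv (convex_Ici 1)
    (fun t ht => (hd t ht).continuousAt.continuousWithinAt)
    (fun t ht => (hd t (interior_subset ht)).differentiableAt.differentiableWithinAt) ?_
  intro x hx y hy hxy
  rw [(hd x (interior_subset hx)).deriv, (hd y (interior_subset hy)).deriv]
  exact exp_div_le_exp_div (Real.one_le_sqrt.2 (interior_subset hx)) (Real.sqrt_le_sqrt hxy)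

lemma tangent_le_expSqrt {t u : ℝ} (ht : 1 ≤ t) (hu : 1 ≤ u) :
    expSqrt t + Real.exp (√t) * (1 / (2 * √t)) * (u - t) ≤ expSqrt u := by
  have hd := hasDerivAt_expSqrt (t := t) (by linarith)
  rcases lt_trichotomy t u with h | rfl | h
  · have := convexOn_expSqrt.le_slope_of_hasDerivAt ht hu h hd
    rw [slope_def_field, le_div_iff₀ (sub_pos.2 h)] at this
    linarith
  · simp
  · have := convexOn_expSqrt.slope_le_of_hasDerivAt hu ht h hd
    rw [slope_def_field, div_le_iff₀ (sub_pos.2 h)] at this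
    linarith

lemma chord_left (a b : ℝ) : chord a b a = expSqrt a := by simp [chord]

lemma chord_right {a b : ℝ} (h : a < b) : chord a b b = expSqrt b := by
  have : b - a ≠ 0 := (sub_pos.2 h).ne'
  rw [chord]
  field_simp
  ring

lemma chord_eq_add (a b t u : ℝ) :
    chord a b u = chord a b t + (expSqrt b - expSqrt a) / (b - a) * (u - t) := by
  rw [chord, chord]
  ring

lemma chord_slope_nonneg {a b : ℝ} (ha : 0 ≤ a) (h : a < b) :
    0 ≤ (expSqrt b - expSqrt a) / (b - a) :=
  div_nonneg (sub_nonneg.2 (expSqrt_mono ha h.le)) (sub_pos.2 h).le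

lemma chord_mono {a b t u : ℝ} (ha : 0 ≤ a) (h : a < b) (htu : t ≤ u) :
    chord a b t ≤ chord a b u := by
  rw [chord_eq_add a b t u]
  linarith [mul_nonneg (chord_slope_nonneg ha h) (sub_nonneg.2 htu)]

lemma expSqrt_le_chord {a b t : ℝ} (ha : 1 ≤ a) (h : a < b) (ht : t ∈ Set.Icc a b) :
    expSqrt t ≤ chord a b t := by
  rcases ht.1.eq_or_lt with rfl | h1
  · rw [chord_left]
  have := convexOn_expSqrt.secant_mono (a := a) (x := t) (y := b) ha (ha.trans ht.1)
    (ha.trans h.le) h1.ne' h.ne' ht.2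
  rw [div_le_iff₀ (sub_pos.2 h1)] at this
  rw [chord]
  linarith

lemma chord_le_expSqrt {a b t : ℝ} (ha : 1 ≤ a) (h : a < b) (ht1 : 1 ≤ t)
    (ht : t ∉ Set.Icc a b) : chord a b t ≤ expSqrt t := by
  rcases lt_or_ge t a with h1 | h1
  · have := convexOn_expSqrt.secant_mono (a := a) (x := t) (y := b) ha ht1
      (ha.trans h.le) h1.ne h.ne' (h1.le.trans h.le)
    rw [div_le_iff_of_neg (sub_neg.2 h1)] at this
    rw [chord]
    linarith
  · have h2 : b < t := by
      by_contra! h2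
      exact ht ⟨h1, h2⟩
    have := convexOn_expSqrt.secant_mono (a := a) (x := b) (y := t) ha (ha.trans h.le) ht1
      h.ne' (h.trans h2).ne' h2.le
    rw [le_div_iff₀ (sub_pos.2 (h.trans h2))] at this
    rw [chord]
    linarith

/-! ### The piecewise function -/

section Phi

variable {s : ℕ → ℝ}

lemma one_lt_of_step (hs0 : 1 < s 0) (hs : ∀ n, s n ≤ s (n + 1) ^ (3 / 4 : ℝ))
    (hpos : ∀ n, 0 < s n) (n : ℕ) : 1 < s n := by
  induction n with
  | zero => exact hs0
  | succ n ih =>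
    by_contra! h
    exact absurd (ih.trans_le (hs n))
      (not_lt.2 (Real.rpow_le_one (hpos _).le h (by norm_num)))

lemma rpow_three_quarters_lt_self {x : ℝ} (hx : 1 < x) : x ^ (3 / 4 : ℝ) < x := by
  conv_rhs => rw [← Real.rpow_one x]
  exact Real.rpow_lt_rpow_of_exponent_lt hx (by norm_num)

/-- Consecutive nodes grow at least like the power `4/3`, which forces divergence. -/
lemma tendsto_of_step (hs0 : 1 < s 0) (hs : ∀ n, s n ≤ s (n + 1) ^ (3 / 4 : ℝ))
    (hpos : ∀ n, 0 < s n) : Tendsto s atTop atTop := by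
  have h1 := one_lt_of_step hs0 hs hpos
  have hl0 : 0 < Real.log (s 0) := Real.log_pos hs0
  -- The linear Bernoulli bound for (4/3)^n is enough.
  have key : ∀ n : ℕ, (1 + n / 3 : ℝ) * Real.log (s 0) ≤ Real.log (s n) := by
    intro n
    induction n with
    | zero => simp
    | succ n ih =>
      have h2 : Real.log (s n) ≤ 3 / 4 * Real.log (s (n + 1)) := by
        rw [← Real.log_rpow (hpos _)]
        exact Real.log_le_log (hpos n) (hs n)
      have h3 : 0 ≤ (n : ℝ) / 3 * Real.log (s 0) := by positivity
      push_cast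
      nlinarith
  have h4 : Tendsto (fun n : ℕ => (1 + n / 3 : ℝ) * Real.log (s 0)) atTop atTop :=
    (tendsto_atTop_add_const_left _ _
      (tendsto_natCast_atTop_atTop.atTop_div_const (by norm_num))).atTop_mul_const hl0
  have h5 := Real.tendsto_exp_atTop.comp (tendsto_atTop_mono key h4)
  refine h5.congr fun n => ?_
  simp [Real.exp_log (hpos n)]

lemma monotone_of_step (hs0 : 1 < s 0) (hs : ∀ n, s n ≤ s (n + 1) ^ (3 / 4 : ℝ))
    (hpos : ∀ n, 0 < s n) : Monotone s :=
  monotone_nat_of_le_succ fun n =>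
    (hs n).trans (rpow_three_quarters_lt_self (one_lt_of_step hs0 hs hpos _)).le

lemma one_le_left_of_step (hs0 : 1 < s 0) (hs : ∀ n, s n ≤ s (n + 1) ^ (3 / 4 : ℝ))
    (hpos : ∀ n, 0 < s n) (n : ℕ) : 1 ≤ s (n + 1) ^ (3 / 4 : ℝ) :=
  (one_lt_of_step hs0 hs hpos n).le.trans (hs n)

/-- Distinct intervals can share only an end point, so the value of `piecewisePhi` does not depend
on the chosen index. -/
lemma chord_eq_expSqrt_of_mem_of_lt (hs0 : 1 < s 0)
    (hs : ∀ n, s n ≤ s (n + 1) ^ (3 / 4 : ℝ)) (hpos : ∀ n, 0 < s n) {m n : ℕ} (hmn : m < n)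
    {t : ℝ} (hm : t ∈ Set.Icc (s (m + 1) ^ (3 / 4 : ℝ)) (s (m + 1)))
    (hn : t ∈ Set.Icc (s (n + 1) ^ (3 / 4 : ℝ)) (s (n + 1))) :
    chord (s (m + 1) ^ (3 / 4 : ℝ)) (s (m + 1)) t = expSqrt t ∧
      chord (s (n + 1) ^ (3 / 4 : ℝ)) (s (n + 1)) t = expSqrt t := by
  have h1 : s (m + 1) ≤ s (n + 1) ^ (3 / 4 : ℝ) :=
    (monotone_of_step hs0 hs hpos (Nat.succ_le_of_lt hmn)).trans (hs n)
  have h2 : t = s (m + 1) := le_antisymm hm.2 (h1.trans hn.1)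
  have h3 : t = s (n + 1) ^ (3 / 4 : ℝ) := le_antisymm (hm.2.trans h1) hn.1
  constructor
  · rw [h2, chord_right (rpow_three_quarters_lt_self (one_lt_of_step hs0 hs hpos _))]
  · rw [h3, chord_left]

lemma piecewisePhi_eq_chord (hs0 : 1 < s 0) (hs : ∀ n, s n ≤ s (n + 1) ^ (3 / 4 : ℝ))
    (hpos : ∀ n, 0 < s n) {n : ℕ} {t : ℝ}
    (ht : t ∈ Set.Icc (s (n + 1) ^ (3 / 4 : ℝ)) (s (n + 1))) :
    piecewisePhi s t = chord (s (n + 1) ^ (3 / 4 : ℝ)) (s (n + 1)) t := by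
  have h : ∃ n : ℕ, t ∈ Set.Icc (s (n + 1) ^ (3 / 4 : ℝ)) (s (n + 1)) := ⟨n, ht⟩
  rw [piecewisePhi, dif_pos h]
  rcases lt_trichotomy h.choose n with hlt | heq | hlt
  · have := chord_eq_expSqrt_of_mem_of_lt hs0 hs hpos hlt h.choose_spec ht
    rw [this.1, this.2]
  · rw [heq]
  · have := chord_eq_expSqrt_of_mem_of_lt hs0 hs hpos hlt ht h.choose_spec
    rw [this.1, this.2]

lemma piecewisePhi_eq_expSqrt {t : ℝ}
    (ht : ¬ ∃ n : ℕ, t ∈ Set.Icc (s (n + 1) ^ (3 / 4 : ℝ)) (s (n + 1))) :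
    piecewisePhi s t = expSqrt t := by
  rw [piecewisePhi, dif_neg ht]

lemma expSqrt_le_piecewisePhi (hs0 : 1 < s 0) (hs : ∀ n, s n ≤ s (n + 1) ^ (3 / 4 : ℝ))
    (hpos : ∀ n, 0 < s n) (t : ℝ) : expSqrt t ≤ piecewisePhi s t := by
  by_cases h : ∃ n : ℕ, t ∈ Set.Icc (s (n + 1) ^ (3 / 4 : ℝ)) (s (n + 1))
  · obtain ⟨n, hn⟩ := h
    rw [piecewisePhi_eq_chord hs0 hs hpos hn]
    exact expSqrt_le_chord (one_le_left_of_step hs0 hs hpos n)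
      (rpow_three_quarters_lt_self (one_lt_of_step hs0 hs hpos _)) hn
  · rw [piecewisePhi_eq_expSqrt h]

/-- On an interval φ is at most its value at the right end, and 2/3 is the quotient of 1/2 by 3/4.
-/
lemma piecewisePhi_le_exp_rpow (hs0 : 1 < s 0) (hs : ∀ n, s n ≤ s (n + 1) ^ (3 / 4 : ℝ))
    (hpos : ∀ n, 0 < s n) {t : ℝ} (ht : 1 ≤ t) :
    piecewisePhi s t ≤ Real.exp (t ^ (2 / 3 : ℝ)) := by
  by_cases h : ∃ n : ℕ, t ∈ Set.Icc (s (n + 1) ^ (3 / 4 : ℝ)) (s (n + 1))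
  · obtain ⟨n, hn⟩ := h
    have hlt := rpow_three_quarters_lt_self (one_lt_of_step hs0 hs hpos (n + 1))
    have h1 := one_le_left_of_step hs0 hs hpos n
    rw [piecewisePhi_eq_chord hs0 hs hpos hn]
    refine (chord_mono (by linarith) hlt hn.2).trans ?_
    rw [chord_right hlt]
    refine Real.exp_le_exp.2 ?_
    calc s (n + 1) ^ (1 / 2 : ℝ) = (s (n + 1) ^ (3 / 4 : ℝ)) ^ (2 / 3 : ℝ) := by
          rw [← Real.rpow_mul (hpos _).le]
          norm_num
      _ ≤ t ^ (2 / 3 : ℝ) := Real.rpow_le_rpow (by linarith) hn.1 (by norm_num)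
  · rw [piecewisePhi_eq_expSqrt h]
    exact Real.exp_le_exp.2 (Real.rpow_le_rpow_of_exponent_le ht (by norm_num))

/-- The piecewise function has a nonnegative subgradient at every point of `[1, ∞)`. -/
lemma exists_subgradient_piecewisePhi (hs0 : 1 < s 0)
    (hs : ∀ n, s n ≤ s (n + 1) ^ (3 / 4 : ℝ)) (hpos : ∀ n, 0 < s n) {t : ℝ} (ht : 1 ≤ t) :
    ∃ p : ℝ, 0 ≤ p ∧ ∀ u, 1 ≤ u → piecewisePhi s t + p * (u - t) ≤ piecewisePhi s u := by
  by_cases h : ∃ n : ℕ, t ∈ Set.Icc (s (n + 1) ^ (3 / 4 : ℝ)) (s (n + 1))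
  · obtain ⟨n, hn⟩ := h
    have hlt := rpow_three_quarters_lt_self (one_lt_of_step hs0 hs hpos (n + 1))
    have h1 := one_le_left_of_step hs0 hs hpos n
    refine ⟨_, chord_slope_nonneg (by linarith) hlt, fun u hu => ?_⟩
    rw [piecewisePhi_eq_chord hs0 hs hpos hn, ← chord_eq_add]
    by_cases hu' : u ∈ Set.Icc (s (n + 1) ^ (3 / 4 : ℝ)) (s (n + 1))
    · rw [piecewisePhi_eq_chord hs0 hs hpos hu']
    · exact (chord_le_expSqrt h1 hlt hu hu').trans (expSqrt_le_piecewisePhi hs0 hs hpos u)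
  · refine ⟨Real.exp (√t) * (1 / (2 * √t)), by positivity, fun u hu => ?_⟩
    rw [piecewisePhi_eq_expSqrt h]
    exact (tangent_le_expSqrt ht hu).trans (expSqrt_le_piecewisePhi hs0 hs hpos u)

end Phi

/-! ### The power series attached to a convex function -/

/-- The exponential of minus the Legendre conjugate of `φ` (on `[1, ∞)`) at the integer `n`. -/
noncomputable def conjCoeff (φ : ℝ → ℝ) (n : ℕ) : ℝ :=
  ⨅ u : Set.Ici (1 : ℝ), Real.exp (φ u - n * u)

/-- The power series with coefficients `conjCoeff φ n`. -/
noncomputable def conjSeries (φ : ℝ → ℝ) (z : ℂ) : ℂ :=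
  ∑' n : ℕ, (conjCoeff φ n : ℂ) * z ^ n

variable {φ : ℝ → ℝ}

lemma conjCoeff_nonneg (n : ℕ) : 0 ≤ conjCoeff φ n :=
  Real.iInf_nonneg fun _ => (Real.exp_pos _).le

lemma conjCoeff_le (n : ℕ) {u : ℝ} (hu : 1 ≤ u) : conjCoeff φ n ≤ Real.exp (φ u - n * u) :=
  ciInf_le (f := fun u : Set.Ici (1 : ℝ) => Real.exp (φ u - n * u))
    ⟨0, by rintro _ ⟨v, rfl⟩; exact (Real.exp_pos _).le⟩ ⟨u, hu⟩

/-- The point u is free: for r = e^t, taking u = t bounds every term by e^{φ(t)}, and u = t + 1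
gives geometric decay. -/
lemma conjCoeff_mul_pow_le (n : ℕ) {u r : ℝ} (hu : 1 ≤ u) (hr : 0 ≤ r) :
    conjCoeff φ n * r ^ n ≤ Real.exp (φ u) * (r * Real.exp (-u)) ^ n := by
  refine (mul_le_mul_of_nonneg_right (conjCoeff_le n hu) (pow_nonneg hr n)).trans_eq ?_
  rw [mul_pow, ← Real.exp_nat_mul, sub_eq_add_neg, Real.exp_add, mul_neg]
  ring

lemma summable_conjCoeff {r : ℝ} (hr : 0 ≤ r) : Summable fun n => conjCoeff φ n * r ^ n := by
  refine Summable.of_nonneg_of_le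
    (fun n => mul_nonneg (conjCoeff_nonneg n) (pow_nonneg hr n))
    (fun n => conjCoeff_mul_pow_le n (u := r + 1) (by linarith) hr) ?_
  refine (summable_geometric_of_lt_one (by positivity) ?_).mul_left _
  rw [Real.exp_neg, ← div_eq_mul_inv, div_lt_one (Real.exp_pos _)]
  linarith [Real.add_one_le_exp (r + 1)]

lemma norm_conjCoeff_mul_pow (n : ℕ) (z : ℂ) :
    ‖(conjCoeff φ n : ℂ) * z ^ n‖ = conjCoeff φ n * ‖z‖ ^ n := by
  rw [norm_mul, norm_pow, Complex.norm_real, Real.norm_of_nonneg (conjCoeff_nonneg n)]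

lemma differentiable_conjSeries : Differentiable ℂ (conjSeries φ) := by
  intro z
  have hz : 0 ≤ ‖z‖ + 1 := by positivity
  have h : DifferentiableOn ℂ (conjSeries φ) (Metric.ball 0 (‖z‖ + 1)) := by
    refine Complex.differentiableOn_tsum_of_summable_norm (summable_conjCoeff (φ := φ) hz)
      (fun n => by fun_prop) Metric.isOpen_ball fun n w hw => ?_
    rw [norm_conjCoeff_mul_pow]
    refine mul_le_mul_of_nonneg_left (pow_le_pow_left₀ (norm_nonneg _) ?_ n) (conjCoeff_nonneg n)
    exact (mem_ball_zero_iff.1 hw).le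
  exact h.differentiableAt (Metric.isOpen_ball.mem_nhds (by simp))

lemma conjSeries_ofReal (r : ℝ) :
    conjSeries φ r = ((∑' n, conjCoeff φ n * r ^ n : ℝ) : ℂ) := by
  rw [conjSeries, Complex.ofReal_tsum]
  push_cast
  rfl

/-- As the coefficients are nonnegative, the maximum modulus is attained on the positive axis. -/
lemma maxModulus_conjSeries {r : ℝ} (hr : 0 ≤ r) :
    maxModulus (conjSeries φ) r = ∑' n, conjCoeff φ n * r ^ n := by
  have hnn : 0 ≤ ∑' n, conjCoeff φ n * r ^ n :=
    tsum_nonneg fun n => mul_nonneg (conjCoeff_nonneg n) (pow_nonneg hr n)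
  refine IsGreatest.csSup_eq ⟨⟨(r : ℂ), ?_, ?_⟩, ?_⟩
  · simp [abs_of_nonneg hr]
  · simp only
    rw [conjSeries_ofReal, Complex.norm_real, Real.norm_of_nonneg hnn]
  · rintro _ ⟨z, hz, rfl⟩
    have hz' : ‖z‖ = r := by simpa using hz
    have h : ∀ n, ‖(conjCoeff φ n : ℂ) * z ^ n‖ = conjCoeff φ n * r ^ n := fun n => by
      rw [norm_conjCoeff_mul_pow, hz']
    refine (norm_tsum_le_tsum_norm ?_).trans_eq (tsum_congr h)
    simp only [h]
    exact summable_conjCoeff hr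

/-- The single term n = ⌊p⌋ suffices. Rounding the slope helps for u ≥ t and costs at most t - u ≤ t
for u ≤ t. -/
lemma exp_sub_le_maxModulus_conjSeries {t p : ℝ} (ht : 1 ≤ t) (hp : 0 ≤ p)
    (hsub : ∀ u, 1 ≤ u → φ t + p * (u - t) ≤ φ u) :
    Real.exp (φ t - t) ≤ maxModulus (conjSeries φ) (Real.exp t) := by
  rw [maxModulus_conjSeries (Real.exp_pos t).le]
  set n := ⌊p⌋₊
  have hn1 : (n : ℝ) ≤ p := Nat.floor_le hp
  have hn2 : p < n + 1 := Nat.lt_floor_add_one p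
  have hco : Real.exp (φ t - t - n * t) ≤ conjCoeff φ n := by
    refine le_ciInf fun ⟨u, hu⟩ => Real.exp_le_exp.2 ?_
    have hu' : (1 : ℝ) ≤ u := hu
    have h := hsub u hu'
    simp only
    rcases le_total u t with hut | hut
    · nlinarith [mul_nonneg (sub_nonneg.2 hn2.le) (sub_nonneg.2 hut)]
    · nlinarith [mul_nonneg (sub_nonneg.2 hn1) (sub_nonneg.2 hut)]
  calc Real.exp (φ t - t) = Real.exp (φ t - t - n * t) * Real.exp t ^ n := by
        rw [← Real.exp_nat_mul, ← Real.exp_add]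
        congr 1
        ring
    _ ≤ conjCoeff φ n * Real.exp t ^ n := by gcongr
    _ ≤ _ := (summable_conjCoeff (Real.exp_pos t).le).le_tsum n fun m _ =>
        mul_nonneg (conjCoeff_nonneg m) (by positivity)

/-- The series is cut at N = ⌈φ(t + 1)⌉: each earlier term is at most e^{φ(t)}, and from N on the
factor e^{-N} absorbs e^{φ(t + 1)}. -/
lemma maxModulus_conjSeries_le {t : ℝ} (ht : 1 ≤ t) (h0 : 0 ≤ φ t) (h1 : 0 ≤ φ (t + 1)) :
    maxModulus (conjSeries φ) (Real.exp t) ≤ (φ (t + 1) + 3) * Real.exp (φ t) := by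
  rw [maxModulus_conjSeries (Real.exp_pos t).le]
  have hsum := summable_conjCoeff (φ := φ) (Real.exp_pos t).le
  set N := ⌈φ (t + 1)⌉₊
  have hN1 : φ (t + 1) ≤ N := Nat.le_ceil _
  have hN2 : (N : ℝ) < φ (t + 1) + 1 := Nat.ceil_lt_add_one h1
  have hq : Real.exp (-1) ≤ 1 / 2 := by
    rw [Real.exp_neg, ← one_div]
    exact one_div_le_one_div_of_le two_pos (by linarith [Real.add_one_le_exp (1 : ℝ)])
  have hhead : ∑ n ∈ Finset.range N, conjCoeff φ n * Real.exp t ^ n ≤ N * Real.exp (φ t) := by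
    calc _ ≤ ∑ n ∈ Finset.range N, Real.exp (φ t) := by
          refine Finset.sum_le_sum fun n _ => ?_
          refine (conjCoeff_mul_pow_le n ht (Real.exp_pos t).le).trans_eq ?_
          simp [← Real.exp_add]
      _ = _ := by simp
  have htail : ∑' n, conjCoeff φ (n + N) * Real.exp t ^ (n + N) ≤ 2 := by
    have hb : ∀ n, conjCoeff φ (n + N) * Real.exp t ^ (n + N) ≤ (1 / 2 : ℝ) ^ n := fun n => by
      refine (conjCoeff_mul_pow_le (n + N) (u := t + 1) (by linarith)
        (Real.exp_pos t).le).trans ?_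
      have e1 : Real.exp t * Real.exp (-(t + 1)) = Real.exp (-1) := by
        rw [← Real.exp_add]
        congr 1
        ring
      have e2 : Real.exp (φ (t + 1)) * Real.exp (-1) ^ N ≤ 1 := by
        rw [← Real.exp_nat_mul, ← Real.exp_add]
        exact Real.exp_le_one_iff.2 (by linarith)
      rw [e1, pow_add, mul_comm (Real.exp (-1) ^ n), ← mul_assoc]
      calc _ ≤ 1 * Real.exp (-1) ^ n := by gcongr
        _ ≤ _ := by
          rw [one_mul]
          gcongr
    calc _ ≤ ∑' n : ℕ, (1 / 2 : ℝ) ^ n :=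
          ((summable_nat_add_iff N).2 hsum).tsum_le_tsum hb summable_geometric_two
      _ = 2 := tsum_geometric_two
  rw [← hsum.sum_add_tsum_nat_add N]
  have h3 : 1 ≤ Real.exp (φ t) := Real.one_le_exp h0
  nlinarith

/-- The logarithm of the maximum modulus differs from `φ` by at most `t + 3`. -/
lemma abs_log_maxModulus_conjSeries_sub_le {t p : ℝ} (ht : 1 ≤ t) (hp : 0 ≤ p)
    (hsub : ∀ u, 1 ≤ u → φ t + p * (u - t) ≤ φ u) (h0 : 0 ≤ φ t) (h1 : 0 ≤ φ (t + 1))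
    (h2 : φ (t + 1) ≤ Real.exp ((t + 1) ^ (2 / 3 : ℝ))) :
    |Real.log (maxModulus (conjSeries φ) (Real.exp t)) - φ t| ≤ t + 3 := by
  have hlow := exp_sub_le_maxModulus_conjSeries ht hp hsub
  have hM := (Real.exp_pos _).trans_le hlow
  have hl : φ t - t ≤ Real.log (maxModulus (conjSeries φ) (Real.exp t)) :=
    (Real.le_log_iff_exp_le hM).2 hlow
  have hu : Real.log (maxModulus (conjSeries φ) (Real.exp t)) ≤ φ t + t + 3 := by
    rw [Real.log_le_iff_le_exp hM]
    refine (maxModulus_conjSeries_le ht h0 h1).trans ?_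
    have e1 : (t + 1) ^ (2 / 3 : ℝ) ≤ t + 1 := by
      conv_rhs => rw [← Real.rpow_one (t + 1)]
      exact Real.rpow_le_rpow_of_exponent_le (by linarith) (by norm_num)
    have e2 : 1 ≤ Real.exp (t + 1) := Real.one_le_exp (by linarith)
    have e3 : (4 : ℝ) ≤ Real.exp 2 := by
      have := Real.quadratic_le_exp_of_nonneg (zero_le_two (α := ℝ))
      linarith
    have e4 : φ (t + 1) + 3 ≤ Real.exp 2 * Real.exp (t + 1) := by
      nlinarith [h2.trans (Real.exp_le_exp.2 e1)]
    calc _ ≤ Real.exp 2 * Real.exp (t + 1) * Real.exp (φ t) := by gcongr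
      _ = Real.exp (φ t + t + 3) := by
        rw [← Real.exp_add, ← Real.exp_add]
        congr 1
        ring
  rw [abs_le]
  constructor <;> linarith

/-! ### Consequences of growth bounds for the maximum modulus -/

lemma tendsto_expSqrt_div_atTop : Tendsto (fun t : ℝ => expSqrt t / t) atTop atTop := by
  refine ((Real.tendsto_exp_div_pow_atTop 2).comp Real.tendsto_sqrt_atTop).congr' ?_
  filter_upwards [eventually_ge_atTop 0] with t ht
  simp only [Function.comp_apply, expSqrt]
  rw [Real.sq_sqrt ht, Real.sqrt_eq_rpow]

lemma tendsto_expSqrt_atTop : Tendsto expSqrt atTop atTop :=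
  Real.tendsto_exp_atTop.comp (tendsto_rpow_atTop (by norm_num))

lemma tendsto_rpow_two_thirds_div_atTop :
    Tendsto (fun t : ℝ => t ^ (2 / 3 : ℝ) / t) atTop (nhds 0) := by
  refine (tendsto_rpow_neg_atTop (y := 1 / 3) (by norm_num)).congr' ?_
  filter_upwards [eventually_gt_atTop 0] with t ht
  rw [← Real.rpow_sub_one ht.ne']
  norm_num

lemma maxModulus_pos_of_log_pos {f : ℂ → ℂ} {r : ℝ} (h : 0 < Real.log (maxModulus f r)) :
    0 < maxModulus f r := by
  have h0 : 0 ≤ maxModulus f r :=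
    Real.sSup_nonneg (by rintro _ ⟨z, _, rfl⟩; exact norm_nonneg _)
  refine h0.lt_of_ne fun h0' => ?_
  rw [← h0', Real.log_zero] at h
  exact h.false

lemma log_maxModulus_le_of_polynomial {f : ℂ → ℂ} {p : Polynomial ℂ}
    (hp : ∀ z, f z = p.eval z) : ∃ C : ℝ, ∀ t : ℝ, 0 ≤ t →
      0 < maxModulus f (Real.exp t) →
      Real.log (maxModulus f (Real.exp t)) ≤ C + p.natDegree * t := by
  set S : ℝ := ∑ i ∈ Finset.range (p.natDegree + 1), ‖p.coeff i‖ with hS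
  have hS0 : 0 ≤ S := Finset.sum_nonneg fun _ _ => norm_nonneg _
  refine ⟨Real.log (S + 1), fun t ht hM => ?_⟩
  have hle : maxModulus f (Real.exp t) ≤ (S + 1) * Real.exp t ^ p.natDegree := by
    refine Real.sSup_le ?_ (by positivity)
    rintro _ ⟨z, hz, rfl⟩
    have hz' : ‖z‖ = Real.exp t := by simpa using hz
    simp only
    rw [hp, Polynomial.eval_eq_sum_range]
    calc _ ≤ ∑ i ∈ Finset.range (p.natDegree + 1), ‖p.coeff i * z ^ i‖ := norm_sum_le _ _
      _ ≤ ∑ i ∈ Finset.range (p.natDegree + 1),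
            ‖p.coeff i‖ * Real.exp t ^ p.natDegree := by
          refine Finset.sum_le_sum fun i hi => ?_
          rw [norm_mul, norm_pow, hz']
          exact mul_le_mul_of_nonneg_left (pow_le_pow_right₀ (Real.one_le_exp ht)
            (Nat.lt_succ_iff.1 (Finset.mem_range.1 hi))) (norm_nonneg _)
      _ = S * Real.exp t ^ p.natDegree := by rw [hS, Finset.sum_mul]
      _ ≤ _ := by gcongr; linarith
  refine (Real.log_le_log hM hle).trans_eq ?_
  rw [Real.log_mul (by positivity) (by positivity), Real.log_pow, Real.log_exp]

/-- A polynomial has log M(e^t) = O(t), while e^√t / t is unbounded. -/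
lemma not_polynomial_of_expSqrt_le {f : ℂ → ℂ}
    (hlow : ∀ᶠ t in atTop, expSqrt t / 2 ≤ Real.log (maxModulus f (Real.exp t))) :
    ¬ ∃ p : Polynomial ℂ, ∀ z, f z = p.eval z := by
  rintro ⟨p, hp⟩
  obtain ⟨C, hC⟩ := log_maxModulus_le_of_polynomial hp
  have h := tendsto_expSqrt_div_atTop.eventually_gt_atTop (2 * (|C| + p.natDegree))
  obtain ⟨t, hlo, hgt, ht⟩ := (hlow.and (h.and (eventually_ge_atTop 1))).exists
  have hE := expSqrt_pos t
  have hM : 0 < maxModulus f (Real.exp t) := maxModulus_pos_of_log_pos (by linarith)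
  have h1 := hC t (by linarith) hM
  rw [lt_div_iff₀ (by linarith)] at hgt
  nlinarith [le_abs_self C, abs_nonneg C, mul_le_mul_of_nonneg_left ht (abs_nonneg C)]

lemma order_eq_zero_of_bounds {f : ℂ → ℂ}
    (hlow : ∀ᶠ t in atTop, expSqrt t / 2 ≤ Real.log (maxModulus f (Real.exp t)))
    (hupp : ∀ᶠ t in atTop,
      Real.log (maxModulus f (Real.exp t)) ≤ 2 * Real.exp (t ^ (2 / 3 : ℝ))) :
    order f = 0 := by
  have h : Tendsto (fun t : ℝ => Real.log (Real.log (maxModulus f (Real.exp t))) / t)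
      atTop (nhds 0) := by
    have hlim : Tendsto (fun t : ℝ => Real.log 2 / t + t ^ (2 / 3 : ℝ) / t) atTop (nhds 0) := by
      simpa using (tendsto_const_nhds.div_atTop tendsto_id).add
        tendsto_rpow_two_thirds_div_atTop
    refine tendsto_of_tendsto_of_tendsto_of_le_of_le' tendsto_const_nhds hlim ?_ ?_
    · filter_upwards [hlow, tendsto_expSqrt_atTop.eventually_ge_atTop 2,
        eventually_gt_atTop 0] with t h1 h2 h3
      exact div_nonneg (Real.log_nonneg (by linarith)) h3.le
    · filter_upwards [hlow, hupp, tendsto_expSqrt_atTop.eventually_ge_atTop 2,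
        eventually_gt_atTop 0] with t h1 h2 h3 h4
      rw [← add_div]
      gcongr
      refine (Real.log_le_log (by linarith) h2).trans_eq ?_
      rw [Real.log_mul two_ne_zero (Real.exp_pos _).ne', Real.log_exp]
  have h2 : Tendsto (fun r : ℝ => Real.log (Real.log (maxModulus f r)) / Real.log r)
      atTop (nhds 0) := by
    refine (h.comp Real.tendsto_log_atTop).congr' ?_
    filter_upwards [eventually_gt_atTop 0] with r hr
    simp [Real.exp_log hr]
  have h3 := (continuous_coe_real_ereal.tendsto (0 : ℝ)).comp h2
  simpa [order, Function.comp_def] using h3.limsup_eq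

/-- The exponent k = 2 serves every ε. With r = e^t, the square root in `expSqrt` turns e^{2t} into
e^t, so the larger side is at least ε(e^t - 1), against at most 4 exp(t^{2/3}) ≤ 4 e^{t/2}. -/
lemma isMLogRegular_two_of_bounds {f : ℂ → ℂ}
    (hlow : ∀ᶠ t in atTop, expSqrt t / 2 ≤ Real.log (maxModulus f (Real.exp t)))
    (hupp : ∀ᶠ t in atTop,
      Real.log (maxModulus f (Real.exp t)) ≤ 2 * Real.exp (t ^ (2 / 3 : ℝ))) :
    IsMLogRegular 2 f := by
  intro ε hε _
  have key : ∀ᶠ t : ℝ in atTop, 0 < maxModulus f (Real.exp t) ∧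
      Real.log (maxModulus f (Real.exp t)) * 2 ≤
        ε * Real.log (Real.log (maxModulus f (Real.exp (Real.exp t ^ (2 : ℝ))))) := by
    have hexp : Tendsto (fun t : ℝ => Real.exp t ^ (2 : ℝ)) atTop atTop :=
      (tendsto_rpow_atTop two_pos).comp Real.tendsto_exp_atTop
    have hhalf : Tendsto (fun t : ℝ => Real.exp (t / 2)) atTop atTop :=
      Real.tendsto_exp_atTop.comp (tendsto_id.atTop_div_const two_pos)
    filter_upwards [hlow, hupp, hexp.eventually hlow, hhalf.eventually_ge_atTop (4 / ε + 1),
      tendsto_rpow_two_thirds_div_atTop.eventually_le_const (show (0 : ℝ) < 1 / 2 by norm_num),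
      eventually_gt_atTop 0] with t h1 h2 h3 h4 h5 h6
    constructor
    · exact maxModulus_pos_of_log_pos (by linarith [expSqrt_pos t])
    · have e1 : expSqrt (Real.exp t ^ (2 : ℝ)) = Real.exp (Real.exp t) := by
        rw [expSqrt, ← Real.rpow_mul (Real.exp_pos t).le]
        norm_num
      rw [e1] at h3
      have e2 : Real.exp t - 1 ≤
          Real.log (Real.log (maxModulus f (Real.exp (Real.exp t ^ (2 : ℝ))))) := by
        refine le_trans ?_ (Real.log_le_log (by positivity) h3)
        rw [Real.log_div (Real.exp_pos _).ne' two_ne_zero, Real.log_exp]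
        linarith [Real.log_two_lt_d9]
      have e3 : t ^ (2 / 3 : ℝ) ≤ t / 2 := by
        rw [div_le_iff₀ h6] at h5
        linarith
      have e4 : Real.exp t = Real.exp (t / 2) * Real.exp (t / 2) := by
        rw [← Real.exp_add]
        congr 1
        ring
      have e5 : 4 + ε ≤ ε * Real.exp (t / 2) := by
        have := mul_le_mul_of_nonneg_left h4 hε.le
        have h7 : ε * (4 / ε + 1) = 4 + ε := by field_simp
        linarith
      have e6 : 1 ≤ Real.exp (t / 2) := Real.one_le_exp (by linarith)
      calc _ ≤ 4 * Real.exp (t / 2) := by linarith [Real.exp_le_exp.2 e3]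
        _ ≤ ε * (Real.exp t - 1) := by
          rw [e4]
          nlinarith [mul_le_mul_of_nonneg_right e5 (Real.exp_pos (t / 2)).le]
        _ ≤ _ := mul_le_mul_of_nonneg_left e2 hε.le
  obtain ⟨R, hR⟩ := eventually_atTop.1 (Real.tendsto_log_atTop.eventually key)
  refine ⟨max R 1, by positivity, 2, one_lt_two, fun r hr => ?_⟩
  obtain ⟨hM, hle⟩ := hR r ((le_max_left _ _).trans hr)
  have hr0 : 0 < r := one_pos.trans_le ((le_max_right _ _).trans hr)
  rw [Real.exp_log hr0] at hM hle
  simp only [mu, Nat.reduceSub, Function.iterate_succ, Function.iterate_zero,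
    Function.comp_apply, id_eq, Real.exp_le_exp]
  rwa [Real.rpow_def_of_pos hM, Real.exp_le_exp]

/-! ### Failure of strong log-regularity -/

/-- As a convex combination of the end points, x/k gives x weight at least 1/(2k); the left end
contributes a nonnegative amount. -/
lemma expSqrt_div_le_chord {k x : ℝ} (hk : 1 < k) (hx : 1 < x)
    (hxk : x ^ (3 / 4 : ℝ) ≤ x / (2 * k)) :
    expSqrt x / (2 * k) ≤ chord (x ^ (3 / 4 : ℝ)) x (x / k) := by
  set a := x ^ (3 / 4 : ℝ) with ha
  have hax : a < x := rpow_three_quarters_lt_self hx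
  have ha0 : 0 < a := by positivity
  have hk0 : 0 < k := by linarith
  have hsplit : x / k = x / (2 * k) + x / (2 * k) := by field_simp; norm_num
  have hkx : x / k < x := div_lt_self (by linarith) hk
  have hE := expSqrt_pos x
  have hEa := expSqrt_pos a
  have hd : 0 < x - a := sub_pos.2 hax
  have e : chord a x (x / k) =
      expSqrt a * ((x - x / k) / (x - a)) + expSqrt x * ((x / k - a) / (x - a)) := by
    rw [chord]
    field_simp
    ring
  have h1 : 0 ≤ expSqrt a * ((x - x / k) / (x - a)) :=
    mul_nonneg hEa.le (div_nonneg (by linarith) hd.le)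
  have h2 : 1 / (2 * k) ≤ (x / k - a) / (x - a) := by
    rw [le_div_iff₀ hd]
    have h3 : 1 / (2 * k) * (x - a) = x / (2 * k) - 1 / (2 * k) * a := by ring
    have h4 : 0 ≤ 1 / (2 * k) * a := by positivity
    linarith
  rw [e]
  have := mul_le_mul_of_nonneg_left h2 hE.le
  rw [mul_one_div] at this
  linarith

lemma not_isStronglyLogRegular_of_bounds {s : ℕ → ℝ} (hs0 : 1 < s 0)
    (hs : ∀ n, s n ≤ s (n + 1) ^ (3 / 4 : ℝ)) (hpos : ∀ n, 0 < s n) {f : ℂ → ℂ}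
    (hlow : ∀ᶠ t in atTop, piecewisePhi s t / 2 ≤ Real.log (maxModulus f (Real.exp t)))
    (hupp : ∀ᶠ t in atTop, Real.log (maxModulus f (Real.exp t)) ≤ 2 * piecewisePhi s t) :
    ¬ IsStronglyLogRegular f := by
  intro hreg
  obtain ⟨R, _, k, hk, hR⟩ := hreg (1 / 2) (by norm_num) (by norm_num)
  have hk0 : 0 < k := by linarith
  have hS : Tendsto (fun n => s (n + 1)) atTop atTop :=
    (tendsto_of_step hs0 hs hpos).comp (tendsto_add_atTop_nat 1)
  have hSk : Tendsto (fun n => s (n + 1) / k) atTop atTop := hS.atTop_div_const hk0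
  have hquart : ∀ᶠ x : ℝ in atTop, x ^ (3 / 4 : ℝ) ≤ x / (2 * k) := by
    filter_upwards [(tendsto_rpow_neg_atTop (y := 1 / 4) (by norm_num)).eventually_le_const
      (show (0 : ℝ) < 1 / (2 * k) by positivity), eventually_gt_atTop 0] with x h1 h2
    have e : x ^ (3 / 4 : ℝ) = x ^ (-(1 / 4) : ℝ) * x := by
      rw [← Real.rpow_add_one h2.ne']
      norm_num
    rw [e]
    calc _ ≤ 1 / (2 * k) * x := by gcongr
      _ = _ := by ring
  -- The test radius is r = exp(x/k) with x = s (n + 1), so that r^k = e^x.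
  obtain ⟨n, h1, h2, h3, h4, h5⟩ := ((hSk.eventually hlow).and ((hS.eventually hupp).and
    ((hS.eventually hquart).and ((hS.eventually (tendsto_expSqrt_atTop.eventually_gt_atTop 32)).and
      ((Real.tendsto_exp_atTop.comp hSk).eventually_gt_atTop R))))).exists
  have hx : 1 < s (n + 1) := one_lt_of_step hs0 hs hpos _
  have hlt := rpow_three_quarters_lt_self hx
  have hreg := hR _ h5
  simp only [Function.comp_apply] at hreg
  rw [← Real.exp_mul, div_mul_cancel₀ _ hk0.ne'] at hreg
  rw [piecewisePhi_eq_chord hs0 hs hpos ⟨hlt.le, le_rfl⟩, chord_right hlt] at h2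
  have hhalf : s (n + 1) / (2 * k) ≤ s (n + 1) / k :=
    div_le_div_of_nonneg_left (by linarith) hk0 (by linarith)
  rw [piecewisePhi_eq_chord hs0 hs hpos
    ⟨h3.trans hhalf, div_le_self (by linarith) hk.le⟩] at h1
  have h6 : expSqrt (s (n + 1)) / 4 ≤
      k * Real.log (maxModulus f (Real.exp (s (n + 1) / k))) := by
    have h7 := (div_le_div_of_nonneg_right (expSqrt_div_le_chord hk hx h3)
      zero_le_two).trans h1
    calc expSqrt (s (n + 1)) / 4 = k * (expSqrt (s (n + 1)) / (2 * k) / 2) := by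
          field_simp
          norm_num
      _ ≤ _ := mul_le_mul_of_nonneg_left h7 hk0.le
  norm_num at hreg
  -- With E = `expSqrt (s (n + 1))`, regularity at ε = 1/2 gives (E/4)² ≤ 2E, that is E ≤ 32.
  have h8 := pow_le_pow_left₀ (by linarith) h6 2
  nlinarith

/-- The maximum modulus of the power series attached to `piecewisePhi s` has the prescribed
growth. -/
lemma isEquivalent_log_maxModulus_conjSeries {s : ℕ → ℝ} (hs0 : 1 < s 0)
    (hs : ∀ n, s n ≤ s (n + 1) ^ (3 / 4 : ℝ)) (hpos : ∀ n, 0 < s n) :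
    IsEquivalent atTop
      (fun t : ℝ => Real.log (maxModulus (conjSeries (piecewisePhi s)) (Real.exp t)))
      (piecewisePhi s) := by
  have hge := expSqrt_le_piecewisePhi hs0 hs hpos
  have hnn : ∀ t, 0 ≤ piecewisePhi s t := fun t => (expSqrt_pos t).le.trans (hge t)
  refine IsLittleO.of_bound fun c hc => ?_
  -- The error satisfies t + 3 ≤ 4t, and 4t ≤ c e^√t eventually.
  filter_upwards [tendsto_expSqrt_div_atTop.eventually_ge_atTop (4 / c),
    eventually_ge_atTop 1] with t h1 ht
  obtain ⟨p, hp, hsub⟩ := exists_subgradient_piecewisePhi hs0 hs hpos ht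
  have hb := abs_log_maxModulus_conjSeries_sub_le ht hp hsub (hnn _) (hnn _)
    (piecewisePhi_le_exp_rpow hs0 hs hpos (by linarith))
  rw [div_le_div_iff₀ hc (by linarith)] at h1
  simp only [Pi.sub_apply, Real.norm_eq_abs]
  rw [abs_of_nonneg (hnn t)]
  nlinarith [mul_le_mul_of_nonneg_left (hge t) hc.le]

end LogReg

theorem mainTheorem10 (s : ℕ → ℝ) (hs0 : 1 < s 0)
    (hs : ∀ n : ℕ, s n ≤ s (n + 1) ^ (3 / 4 : ℝ)) (hpos : ∀ n : ℕ, 0 < s n) :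
    ∃ f : ℂ → ℂ,
      LogReg.IsTranscendentalEntire f ∧
      LogReg.order f = 0 ∧
      Asymptotics.IsEquivalent Filter.atTop
        (fun t : ℝ => Real.log (LogReg.maxModulus f (Real.exp t))) (LogReg.piecewisePhi s) ∧
      LogReg.IsMLogRegular 2 f ∧
      ¬ LogReg.IsStronglyLogRegular f := by
  have heq := LogReg.isEquivalent_log_maxModulus_conjSeries hs0 hs hpos
  have hge := LogReg.expSqrt_le_piecewisePhi hs0 hs hpos
  have hbd := heq.isLittleO.bound (show (0 : ℝ) < 1 / 2 by norm_num)
  have habs : ∀ᶠ t in atTop, LogReg.piecewisePhi s t / 2 ≤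
        Real.log (LogReg.maxModulus (LogReg.conjSeries (LogReg.piecewisePhi s)) (Real.exp t)) ∧
      Real.log (LogReg.maxModulus (LogReg.conjSeries (LogReg.piecewisePhi s)) (Real.exp t)) ≤
        2 * LogReg.piecewisePhi s t := by
    filter_upwards [hbd] with t ht
    have h0 := (LogReg.expSqrt_pos t).le.trans (hge t)
    simp only [Pi.sub_apply, Real.norm_eq_abs] at ht
    rw [abs_of_nonneg h0, abs_le] at ht
    constructor <;> linarith [ht.1, ht.2]
  have hlow := habs.mono fun t ht =>
    (div_le_div_of_nonneg_right (hge t) zero_le_two).trans ht.1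
  have hupp := (habs.and (eventually_ge_atTop 1)).mono fun t ht => ht.1.2.trans
    (mul_le_mul_of_nonneg_left (LogReg.piecewisePhi_le_exp_rpow hs0 hs hpos ht.2) zero_le_two)
  exact ⟨LogReg.conjSeries (LogReg.piecewisePhi s),
    ⟨LogReg.differentiable_conjSeries, LogReg.not_polynomial_of_expSqrt_le hlow⟩,
    LogReg.order_eq_zero_of_bounds hlow hupp, heq,
    LogReg.isMLogRegular_two_of_bounds hlow hupp,
    LogReg.not_isStronglyLogRegular_of_bounds hs0 hs hpos
      (habs.mono fun _ h => h.1) (habs.mono fun _ h => h.2)⟩
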